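/- **Calculi.** Terms are considered up to renaming of bound variables. dCBN and dCBV share the syntax $M,N ::= x \mid \lambda x M \mid MN \mid M[N/x]$, where $M[N/x]$ is an explicit substitution binding $x$ in $M$; values $V$ are variables and abstractions. The syntax of dBang is $M,N ::= x \mid \lambda x M \mid MN \mid {!M} \mid \mathrm{der}(M) \mid M[N/x]$. List contexts are $L ::= \square \mid L[M/x]$; below, no free variable of the term moved into $L$ is captured by $L$, and $M\{N/x\}$ is capture-avoiding substitution. The reductions are the closures under all contexts of * dCBN ($\to_n$): $L\langle\lambda x M\rangle N \to L\langle M[N/x]\rangle$ and $M[N/x]\to M\{N/x\}$; * dCBV ($\to_v$): $L\langle\lambda x M\rangle N \to L\langle M[N/x]\rangle$ and $M[L\langle V\rangle/x]\to L\langle M\{V/x\}\rangle$ for values $V$; * dBang ($\to_!$): $L\langle\lambda x M\rangle N \to L\langle M[N/x]\rangle$, $M[L\langle {!N}\rangle/x]\to L\langle M\{N/x\}\rangle$ and $\mathrm{der}(L\langle {!N}\rangle)\to L\langle N\rangle$. **Translations into dBang.** Call-by-name: $x^n=x$, $(\lambda xM)^n=\lambda x M^n$, $(MN)^n=M^n\,{!N^n}$,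 $(M[N/x])^n=M^n[{!N^n}/x]$. Call-by-value: $x^v={!x}$, $(\lambda xM)^v={!(\lambda xM^v)}$, $(M[N/x])^v=M^v[N^v/x]$, and $(MN)^v=L\langle P\rangle N^v$ if $M^v=L\langle{!P}\rangle$, $(MN)^v=\mathrm{der}(M^v)\,N^v$ otherwise. Both are extended to terms with a constant $\bot$ by $\bot^n=\bot^v=\bot$. **Approximants.** * dCBN approximants: $A ::= \bot\mid N_\lambda\mid\lambda xA$, with $N_\lambda ::= x\mid N_\lambda A$. * dCBV approximants: $A ::= \bot\mid A_\lambda\mid\lambda xA\mid A[A_{x\lambda}/x]$, with $A_\lambda ::= x\mid A_\lambda A\mid A_\lambda[A_{x\lambda}/x]$ and $A_{x\lambda} ::= A_\lambda A\mid A_{x\lambda}[A_{x\lambda}/x]$. * dBang approximants: $A ::= \bot\mid A_!\mid A_\lambda\mid A[A_!/x]$, with $A_! ::= x\mid\lambda xA\mid A_\lambda A\mid \mathrm{der}(A_!)\mid A_![A_!/x]$ and $A_\lambda ::= x\mid {!A}\mid A_\lambda A\mid\mathrm{der}(A_!)\mid A_\lambda[A_!/x]$. The translations send dCBN and dCBV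 approximants to dBang approximants. Write $A\sqsubseteq N$ if $A$ is obtained from $N$ by replacing subterms by $\bot$. **Böhm trees.** A Böhm tree is represented by the set of its finite approximants, a $\sqsubseteq$-downward closed set of approximants. For $\circ\in\{n,v,!\}$, $\mathrm{BT}_\circ(M)$ is the set of all approximants $A$ of the calculus such that $M\to_\circ^* N$ and $A\sqsubseteq N$ for some $N$. For $\circ\in\{n,v\}$ the translation of a Böhm tree $T$ is the supremum of the translations of its finite approximants, that is, $T^\circ=\{B \text{ a dBang approximant}\mid B\sqsubseteq A^\circ\text{ for some }A\in T\}$. **Theorem.** 1. For every dCBN term $M$, $(\mathrm{BT}_n(M))^n=\mathrm{BT}_!(M^n)$. 2. For every dCBV term $M$, $(\mathrm{BT}_v(M))^v=\mathrm{BT}_!(M^v)$. -/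

import Mathlib

/-! ## The common syntax of dCBN and dCBV

Terms are taken up to renaming of bound variables, by way of de Bruijn indices. The syntax has an
additional constant `bot` for the approximants; the terms of dCBN and dCBV are the `bot`-free
expressions. -/

/-- `lam M` and `es M N` (the explicit substitution `M[N/x]`) bind the index `0` in `M`. -/
inductive Lam : Type
  | bot : Lam
  | var : ℕ → Lam
  | lam : Lam → Lam
  | app : Lam → Lam → Lam
  | es : Lam → Lam → Lam

/-- Extension of a renaming under a binder. -/
def liftRen (f : ℕ → ℕ) : ℕ → ℕ
  | 0 => 0
  | i + 1 => f i + 1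

namespace Lam

/-- The expressions without `bot`: the terms of dCBN and dCBV. -/
def BotFree : Lam → Prop
  | bot => False
  | var _ => True
  | lam M => M.BotFree
  | app M N => M.BotFree ∧ N.BotFree
  | es M N => M.BotFree ∧ N.BotFree

def rename (f : ℕ → ℕ) : Lam → Lam
  | bot => bot
  | var i => var (f i)
  | lam M => lam (M.rename (liftRen f))
  | app M N => app (M.rename f) (N.rename f)
  | es M N => es (M.rename (liftRen f)) (N.rename f)

/-- Extension of a substitution under a binder. -/
def up (σ : ℕ → Lam) : ℕ → Lam
  | 0 => var 0
  | i + 1 => (σ i).rename Nat.succ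

/-- Simultaneous capture-avoiding substitution. -/
def subst (σ : ℕ → Lam) : Lam → Lam
  | bot => bot
  | var i => σ i
  | lam M => lam (M.subst (up σ))
  | app M N => app (M.subst σ) (N.subst σ)
  | es M N => es (M.subst (up σ)) (N.subst σ)

/-- The substitution that replaces the index `0` by `N`, where the result is placed under `k`
additional binders which `N` may use and which the other variables have to skip. -/
def inst (N : Lam) (k : ℕ) : ℕ → Lam
  | 0 => N
  | i + 1 => var (i + k)

/-- A list context `□[N₁/x₁]…[Nₖ/xₖ]` is the list `[N₁, …, Nₖ]`, and `plug L M` is `L⟨M⟩`. -/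
def plug : List Lam → Lam → Lam
  | [], M => M
  | N :: L, M => plug L (es M N)

/-- Values: variables and abstractions. -/
inductive IsValue : Lam → Prop
  | var (i : ℕ) : IsValue (var i)
  | lam (M : Lam) : IsValue (lam M)

/-- Closure of a relation under all contexts. -/
inductive Ctx (R : Lam → Lam → Prop) : Lam → Lam → Prop
  | root {M M' : Lam} : R M M' → Ctx R M M'
  | lam {M M' : Lam} : Ctx R M M' → Ctx R (lam M) (lam M')
  | appL {M M' : Lam} (N : Lam) : Ctx R M M' → Ctx R (app M N) (app M' N)
  | appR (M : Lam) {N N' : Lam} : Ctx R N N' → Ctx R (app M N) (app M N')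
  | esL {M M' : Lam} (N : Lam) : Ctx R M M' → Ctx R (es M N) (es M' N)
  | esR (M : Lam) {N N' : Lam} : Ctx R N N' → Ctx R (es M N) (es M N')

/-- `L⟨λx M⟩ N → L⟨M[N/x]⟩` and `M[N/x] → M{N/x}`. -/
inductive RootN : Lam → Lam → Prop
  | beta (L : List Lam) (M N : Lam) :
      RootN (app (plug L (lam M)) N) (plug L (es M (N.rename (· + L.length))))
  | sub (M N : Lam) : RootN (es M N) (M.subst (inst N 0))

/-- `L⟨λx M⟩ N → L⟨M[N/x]⟩` and `M[L⟨V⟩/x] → L⟨M{V/x}⟩` for values `V`. -/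
inductive RootV : Lam → Lam → Prop
  | beta (L : List Lam) (M N : Lam) :
      RootV (app (plug L (lam M)) N) (plug L (es M (N.rename (· + L.length))))
  | sub (L : List Lam) (M V : Lam) : IsValue V →
      RootV (es M (plug L V)) (plug L (M.subst (inst V L.length)))

/-- The one-step reduction of dCBN. -/
def StepN : Lam → Lam → Prop := Ctx RootN

/-- The one-step reduction of dCBV. -/
def StepV : Lam → Lam → Prop := Ctx RootV

/-- `M ⊑ N`: `M` is obtained from `N` by replacing subterms by `bot`. -/
inductive Below : Lam → Lam → Prop
  | bot (N : Lam) : Below bot N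
  | var (i : ℕ) : Below (var i) (var i)
  | lam {M M' : Lam} : Below M M' → Below (lam M) (lam M')
  | app {M M' N N' : Lam} : Below M M' → Below N N' → Below (app M N) (app M' N')
  | es {M M' N N' : Lam} : Below M M' → Below N N' → Below (es M N) (es M' N')

theorem Below.refl : ∀ M : Lam, Below M M
  | .bot => .bot _
  | .var i => .var i
  | .lam M => .lam (Below.refl M)
  | .app M N => .app (Below.refl M) (Below.refl N)
  | .es M N => .es (Below.refl M) (Below.refl N)

theorem Below.trans {M N : Lam} (h : Below M N) : ∀ {P : Lam}, Below N P → Below M P := by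
  induction h with
  | bot => intro P _; exact .bot P
  | var i => intro P hP; exact hP
  | lam _ ih => intro P hP; cases hP with | lam h => exact .lam (ih h)
  | app _ _ ih₁ ih₂ => intro P hP; cases hP with | app h k => exact .app (ih₁ h) (ih₂ k)
  | es _ _ ih₁ ih₂ => intro P hP; cases hP with | es h k => exact .es (ih₁ h) (ih₂ k)

end Lam

/-! ## The distant Bang-calculus dBang -/

/-- `lam M` and `es M N` bind the index `0` in `M`; the terms of dBang are the `bot`-free
expressions. -/
inductive Bang : Type
  | bot : Bang
  | var : ℕ → Bang
  | lam : Bang → Bang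
  | app : Bang → Bang → Bang
  | bang : Bang → Bang
  | der : Bang → Bang
  | es : Bang → Bang → Bang

namespace Bang

def rename (f : ℕ → ℕ) : Bang → Bang
  | bot => bot
  | var i => var (f i)
  | lam M => lam (M.rename (liftRen f))
  | app M N => app (M.rename f) (N.rename f)
  | bang M => bang (M.rename f)
  | der M => der (M.rename f)
  | es M N => es (M.rename (liftRen f)) (N.rename f)

/-- Extension of a substitution under a binder. -/
def up (σ : ℕ → Bang) : ℕ → Bang
  | 0 => var 0
  | i + 1 => (σ i).rename Nat.succ

/-- Simultaneous capture-avoiding substitution. -/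
def subst (σ : ℕ → Bang) : Bang → Bang
  | bot => bot
  | var i => σ i
  | lam M => lam (M.subst (up σ))
  | app M N => app (M.subst σ) (N.subst σ)
  | bang M => bang (M.subst σ)
  | der M => der (M.subst σ)
  | es M N => es (M.subst (up σ)) (N.subst σ)

/-- The substitution that replaces the index `0` by `N`, where the result is placed under `k`
additional binders which `N` may use and which the other variables have to skip. -/
def inst (N : Bang) (k : ℕ) : ℕ → Bang
  | 0 => N
  | i + 1 => var (i + k)

/-- A list context `□[N₁/x₁]…[Nₖ/xₖ]` is the list `[N₁, …, Nₖ]`, and `plug L M` is `L⟨M⟩`. -/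
def plug : List Bang → Bang → Bang
  | [], M => M
  | N :: L, M => plug L (es M N)

/-- `L⟨λx M⟩ N → L⟨M[N/x]⟩`, `M[L⟨!N⟩/x] → L⟨M{N/x}⟩` and `der (L⟨!N⟩) → L⟨N⟩`. -/
inductive Root : Bang → Bang → Prop
  | beta (L : List Bang) (M N : Bang) :
      Root (app (plug L (lam M)) N) (plug L (es M (N.rename (· + L.length))))
  | sub (L : List Bang) (M N : Bang) :
      Root (es M (plug L (bang N))) (plug L (M.subst (inst N L.length)))
  | der (L : List Bang) (N : Bang) : Root (der (plug L (bang N))) (plug L N)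

/-- The one-step reduction of dBang, under full contexts (in particular, under `!`). -/
inductive Step : Bang → Bang → Prop
  | root {M M' : Bang} : Root M M' → Step M M'
  | lam {M M' : Bang} : Step M M' → Step (lam M) (lam M')
  | appL {M M' : Bang} (N : Bang) : Step M M' → Step (app M N) (app M' N)
  | appR (M : Bang) {N N' : Bang} : Step N N' → Step (app M N) (app M N')
  | bang {M M' : Bang} : Step M M' → Step (bang M) (bang M')
  | der {M M' : Bang} : Step M M' → Step (der M) (der M')
  | esL {M M' : Bang} (N : Bang) : Step M M' → Step (es M N) (es M' N)
  | esR (M : Bang) {N N' : Bang} : Step N N' → Step (es M N) (es M N')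

/-- `M ⊑ N`: `M` is obtained from `N` by replacing subterms by `bot`. -/
inductive Below : Bang → Bang → Prop
  | bot (N : Bang) : Below bot N
  | var (i : ℕ) : Below (var i) (var i)
  | lam {M M' : Bang} : Below M M' → Below (lam M) (lam M')
  | app {M M' N N' : Bang} : Below M M' → Below N N' → Below (app M N) (app M' N')
  | bang {M M' : Bang} : Below M M' → Below (bang M) (bang M')
  | der {M M' : Bang} : Below M M' → Below (der M) (der M')
  | es {M M' N N' : Bang} : Below M M' → Below N N' → Below (es M N) (es M' N')

theorem Below.refl : ∀ M : Bang, Below M M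
  | .bot => .bot _
  | .var i => .var i
  | .lam M => .lam (Below.refl M)
  | .app M N => .app (Below.refl M) (Below.refl N)
  | .bang M => .bang (Below.refl M)
  | .der M => .der (Below.refl M)
  | .es M N => .es (Below.refl M) (Below.refl N)

theorem Below.trans {M N : Bang} (h : Below M N) : ∀ {P : Bang}, Below N P → Below M P := by
  induction h with
  | bot => intro P _; exact .bot P
  | var i => intro P hP; exact hP
  | lam _ ih => intro P hP; cases hP with | lam h => exact .lam (ih h)
  | app _ _ ih₁ ih₂ => intro P hP; cases hP with | app h k => exact .app (ih₁ h) (ih₂ k)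
  | bang _ ih => intro P hP; cases hP with | bang h => exact .bang (ih h)
  | der _ ih => intro P hP; cases hP with | der h => exact .der (ih h)
  | es _ _ ih₁ ih₂ => intro P hP; cases hP with | es h k => exact .es (ih₁ h) (ih₂ k)

/-- `L⟨!P⟩ ↦ L⟨P⟩`, undefined on the terms that are not of the form `L⟨!P⟩`. -/
def unbang : Bang → Option Bang
  | bang P => some P
  | es M N => (unbang M).map (fun Q => es Q N)
  | _ => none

theorem unbang_plug :
    ∀ (L : List Bang) (Q R : Bang), Q.unbang = some R → (plug L Q).unbang = some (plug L R)
  | [], _, _, h => h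
  | _ :: L, _, _, h => unbang_plug L _ _ (by simp [unbang, h])

theorem plug_append : ∀ (L K : List Bang) (M : Bang), plug (L ++ K) M = plug K (plug L M)
  | [], _, _ => rfl
  | _ :: L, K, _ => plug_append L K _

theorem unbang_eq_some (M Q : Bang) :
    M.unbang = some Q ↔ ∃ (L : List Bang) (P : Bang), M = plug L (bang P) ∧ Q = plug L P := by
  constructor
  · induction M generalizing Q with
    | bang P _ =>
      intro h
      simp only [unbang, Option.some.injEq] at h
      exact ⟨[], P, rfl, h.symm⟩
    | es M N ih _ =>
      intro h
      simp only [unbang, Option.map_eq_some_iff] at h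
      obtain ⟨R, hR, rfl⟩ := h
      obtain ⟨L, P, rfl, rfl⟩ := ih R hR
      exact ⟨L ++ [N], P, by rw [plug_append]; rfl, by rw [plug_append]; rfl⟩
    | _ => intro h; simp [unbang] at h
  · rintro ⟨L, P, rfl, rfl⟩
    exact unbang_plug L _ _ rfl

end Bang

/-! ## The translations, on terms and on approximants -/

namespace Lam

/-- The call-by-name translation. -/
def toN : Lam → Bang
  | bot => .bot
  | var i => .var i
  | lam M => .lam M.toN
  | app M N => .app M.toN (.bang N.toN)
  | es M N => .es M.toN (.bang N.toN)

/-- The call-by-value translation. The translation of an application `M N` is `L⟨P⟩ Nᵛ` if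
`Mᵛ = L⟨!P⟩`, and `der(Mᵛ) Nᵛ` otherwise. -/
def toV : Lam → Bang
  | bot => .bot
  | var i => .bang (.var i)
  | lam M => .bang (.lam M.toV)
  | app M N => .app (M.toV.unbang.getD (.der M.toV)) N.toV
  | es M N => .es M.toV N.toV

end Lam

/-! ## Approximants -/

/-- Nonterminals of the grammar of dCBN approximants. -/
inductive CatN : Type
  | A
  | Nlam

/-- `A ::= ⊥ | N_λ | λx A` and `N_λ ::= x | N_λ A`. -/
inductive GramN : CatN → Lam → Prop
  | bot : GramN .A .bot
  | ofNlam {M : Lam} : GramN .Nlam M → GramN .A M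
  | lam {M : Lam} : GramN .A M → GramN .A (.lam M)
  | var (i : ℕ) : GramN .Nlam (.var i)
  | app {M N : Lam} : GramN .Nlam M → GramN .A N → GramN .Nlam (.app M N)

/-- Nonterminals of the grammar of dCBV approximants. -/
inductive CatV : Type
  | A
  | Alam
  | Axlam

/-- `A ::= ⊥ | A_λ | λx A | A[A_xλ/x]`, `A_λ ::= x | A_λ A | A_λ[A_xλ/x]` and
`A_xλ ::= A_λ A | A_xλ[A_xλ/x]`. -/
inductive GramV : CatV → Lam → Prop
  | bot : GramV .A .bot
  | ofAlam {M : Lam} : GramV .Alam M → GramV .A M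
  | lam {M : Lam} : GramV .A M → GramV .A (.lam M)
  | esA {M N : Lam} : GramV .A M → GramV .Axlam N → GramV .A (.es M N)
  | var (i : ℕ) : GramV .Alam (.var i)
  | appAlam {M N : Lam} : GramV .Alam M → GramV .A N → GramV .Alam (.app M N)
  | esAlam {M N : Lam} : GramV .Alam M → GramV .Axlam N → GramV .Alam (.es M N)
  | appAxlam {M N : Lam} : GramV .Alam M → GramV .A N → GramV .Axlam (.app M N)
  | esAxlam {M N : Lam} : GramV .Axlam M → GramV .Axlam N → GramV .Axlam (.es M N)

/-- Nonterminals of the grammar of dBang approximants: `Abang` and `Alam` are those approximants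
which are neither of the form `L⟨⊥⟩` nor, respectively, of the form `L⟨!P⟩`, `L⟨λx P⟩`. -/
inductive CatB : Type
  | A
  | Abang
  | Alam

/-- `A ::= ⊥ | A_! | A_λ | A[A_!/x]`, `A_! ::= x | λx A | A_λ A | der A_! | A_![A_!/x]` and
`A_λ ::= x | !A | A_λ A | der A_! | A_λ[A_!/x]`. -/
inductive GramB : CatB → Bang → Prop
  | bot : GramB .A .bot
  | ofAbang {M : Bang} : GramB .Abang M → GramB .A M
  | ofAlam {M : Bang} : GramB .Alam M → GramB .A M
  | esA {M N : Bang} : GramB .A M → GramB .Abang N → GramB .A (.es M N)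
  | varAbang (i : ℕ) : GramB .Abang (.var i)
  | lam {M : Bang} : GramB .A M → GramB .Abang (.lam M)
  | appAbang {M N : Bang} : GramB .Alam M → GramB .A N → GramB .Abang (.app M N)
  | derAbang {M : Bang} : GramB .Abang M → GramB .Abang (.der M)
  | esAbang {M N : Bang} : GramB .Abang M → GramB .Abang N → GramB .Abang (.es M N)
  | varAlam (i : ℕ) : GramB .Alam (.var i)
  | bang {M : Bang} : GramB .A M → GramB .Alam (.bang M)
  | appAlam {M N : Bang} : GramB .Alam M → GramB .A N → GramB .Alam (.app M N)
  | derAlam {M : Bang} : GramB .Abang M → GramB .Alam (.der M)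
  | esAlam {M N : Bang} : GramB .Alam M → GramB .Abang N → GramB .Alam (.es M N)

/-- dCBN approximants. -/
def ApproxN : Type := {M : Lam // GramN .A M}

/-- dCBV approximants. -/
def ApproxV : Type := {M : Lam // GramV .A M}

/-- dBang approximants. -/
def ApproxB : Type := {M : Bang // GramB .A M}

instance : Preorder ApproxN where
  le A B := Lam.Below A.1 B.1
  le_refl A := Lam.Below.refl A.1
  le_trans _ _ _ h k := Lam.Below.trans h k

instance : Preorder ApproxV where
  le A B := Lam.Below A.1 B.1
  le_refl A := Lam.Below.refl A.1
  le_trans _ _ _ h k := Lam.Below.trans h k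

instance : Preorder ApproxB where
  le A B := Bang.Below A.1 B.1
  le_refl A := Bang.Below.refl A.1
  le_trans _ _ _ h k := Bang.Below.trans h k

/-! ## The translations send approximants to approximants -/

theorem GramN.toN {c : CatN} {M : Lam} (h : GramN c M) :
    GramB .A M.toN ∧ (c = .Nlam → GramB .Alam M.toN) := by
  induction h with
  | bot => exact ⟨.bot, by simp⟩
  | ofNlam _ ih => exact ⟨ih.1, by simp⟩
  | lam _ ih => exact ⟨.ofAbang (.lam ih.1), by simp⟩
  | var i => exact ⟨.ofAlam (.varAlam i), fun _ => .varAlam i⟩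
  | app _ _ ih₁ ih₂ =>
    have h := GramB.appAlam (ih₁.2 rfl) (.ofAlam (.bang ih₂.1))
    exact ⟨.ofAlam h, fun _ => h⟩

theorem GramV.toV {c : CatV} {M : Lam} (h : GramV c M) :
    GramB .A M.toV ∧ (c = .Axlam → GramB .Abang M.toV ∧ GramB .Alam M.toV ∧ M.toV.unbang = none) ∧
      (c = .Alam → GramB .Alam (M.toV.unbang.getD (.der M.toV)) ∧
        (M.toV.unbang = none → GramB .Abang M.toV)) := by
  induction h with
  | bot => exact ⟨.bot, by simp, by simp⟩
  | ofAlam _ ih => exact ⟨ih.1, by simp, by simp⟩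
  | lam _ ih => exact ⟨.ofAlam (.bang (.ofAbang (.lam ih.1))), by simp, by simp⟩
  | esA _ _ ih₁ ih₂ => exact ⟨.esA ih₁.1 (ih₂.2.1 rfl).1, by simp, by simp⟩
  | var i =>
    exact ⟨.ofAlam (.bang (.ofAlam (.varAlam i))), by simp,
      fun _ => ⟨.varAlam i, fun h => by simp [Lam.toV, Bang.unbang] at h⟩⟩
  | appAlam _ _ ih₁ ih₂ =>
    have h := (ih₁.2.2 rfl).1
    refine ⟨.ofAlam (.appAlam h ih₂.1), by simp, fun _ => ⟨?_, fun _ => .appAbang h ih₂.1⟩⟩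
    exact .derAlam (.appAbang h ih₂.1)
  | @esAlam M N _ _ ih₁ ih₂ =>
    have h := (ih₂.2.1 rfl).1
    refine ⟨.esA ih₁.1 h, by simp, fun _ => ⟨?_, fun k => ?_⟩⟩
    · have k := (ih₁.2.2 rfl)
      cases e : M.toV.unbang with
      | none =>
        simp only [Lam.toV, Bang.unbang, e, Option.map_none, Option.getD_none]
        exact .derAlam (.esAbang (k.2 e) h)
      | some Q =>
        simp only [Lam.toV, Bang.unbang, e, Option.map_some, Option.getD_some]
        rw [e] at k
        exact .esAlam k.1 h
    · refine .esAbang ((ih₁.2.2 rfl).2 ?_) h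
      simpa [Lam.toV, Bang.unbang] using k
  | appAxlam _ _ ih₁ ih₂ =>
    have h := (ih₁.2.2 rfl).1
    exact ⟨.ofAlam (.appAlam h ih₂.1),
      fun _ => ⟨.appAbang h ih₂.1, .appAlam h ih₂.1, rfl⟩, by simp⟩
  | esAxlam _ _ ih₁ ih₂ =>
    have h := (ih₂.2.1 rfl).1
    have k := ih₁.2.1 rfl
    exact ⟨.esA ih₁.1 h, fun _ => ⟨.esAbang k.1 h, .esAlam k.2.1 h,
      by simp [Lam.toV, Bang.unbang, k.2.2]⟩, by simp⟩

/-- The call-by-name translation of approximants. -/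
def ApproxN.toB (A : ApproxN) : ApproxB := ⟨A.1.toN, A.2.toN.1⟩

/-- The call-by-value translation of approximants. -/
def ApproxV.toB (A : ApproxV) : ApproxB := ⟨A.1.toV, A.2.toV.1⟩

/-! ## Böhm trees

A (possibly infinite) Böhm tree is represented, as in the ideal completion of the ordered set of
approximants, by the downward closed set of all its finite approximants. -/

/-- The Böhm tree of a dCBN term. -/
def BTn (M : Lam) : LowerSet ApproxN where
  carrier := {A | ∃ N, Relation.ReflTransGen Lam.StepN M N ∧ Lam.Below A.1 N}
  lower' := fun _ _ hBA ⟨N, hN, hA⟩ => ⟨N, hN, Lam.Below.trans hBA hA⟩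

/-- The Böhm tree of a dCBV term. -/
def BTv (M : Lam) : LowerSet ApproxV where
  carrier := {A | ∃ N, Relation.ReflTransGen Lam.StepV M N ∧ Lam.Below A.1 N}
  lower' := fun _ _ hBA ⟨N, hN, hA⟩ => ⟨N, hN, Lam.Below.trans hBA hA⟩

/-- The Böhm tree of a dBang term. -/
def BTb (M : Bang) : LowerSet ApproxB where
  carrier := {A | ∃ N, Relation.ReflTransGen Bang.Step M N ∧ Bang.Below A.1 N}
  lower' := fun _ _ hBA ⟨N, hN, hA⟩ => ⟨N, hN, Bang.Below.trans hBA hA⟩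

/-- The call-by-name translation of a Böhm tree: the supremum (in the completion) of the
translations of its finite approximants. -/
def treeToN (T : LowerSet ApproxN) : LowerSet ApproxB := lowerClosure (ApproxN.toB '' T)

/-- The call-by-value translation of a Böhm tree: the supremum (in the completion) of the
translations of its finite approximants. -/
def treeToV (T : LowerSet ApproxV) : LowerSet ApproxB := lowerClosure (ApproxV.toB '' T)

/-! ### Multi-step reduction inside contexts. -/

open Relation

/-! Each equality needs reduction to be simulated in both directions, and the translation to match
approximants below a term with approximants below its image. From left to right, translate a
reduction `M →* N` and use monotonicity of the translation on approximants. From right to left, lift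
a reduction of the image back to a reduction of `M`, and lift a dBang approximant below the image of
the reduct to a source approximant below the reduct (`exists_gramN_of_below_toN`,
`exists_gramV_of_below_toV`).

In call-by-name, steps of `M` and of its image correspond one to one. In call-by-value they do not:
a step inside a function may turn it into some `L⟨V⟩`, and the translation then removes a `der` that
the dBang reduct still contains. The relation `TransV` absorbs this by leaving the contraction of
such `der` redexes optional. It is preserved by steps on either side, and every related term reduces
to the actual translation (`star_toV`). Hence a reduct `Q` of the image of `M` only satisfies `Q →*
M'.toV` for some reduct `M'` of `M`. This is enough, because an approximant below a dBang term stays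
below all its reducts (`GramB.below_of_star`): the grammar rules out redexes in approximants, so
each redex of the term is hidden under some `⊥`. -/

theorem Relation.ReflTransGen.mapStep {α β : Type*} {r : α → α → Prop} {p : β → β → Prop}
    {a b : α} (h : ReflTransGen r a b) (f : α → β) (hf : ∀ {a b}, r a b → p (f a) (f b)) :
    ReflTransGen p (f a) (f b) :=
  ReflTransGen.lift f (fun _ _ => hf) _ _ h

namespace Bang

theorem Step.star_lam {M M' : Bang} (h : ReflTransGen Step M M') :
    ReflTransGen Step (.lam M) (.lam M') :=
  h.mapStep Bang.lam .lam

theorem Step.star_bang {M M' : Bang} (h : ReflTransGen Step M M') :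
    ReflTransGen Step (.bang M) (.bang M') :=
  h.mapStep Bang.bang .bang

theorem Step.star_der {M M' : Bang} (h : ReflTransGen Step M M') :
    ReflTransGen Step (.der M) (.der M') :=
  h.mapStep Bang.der .der

theorem Step.star_app {M M' N N' : Bang} (h : ReflTransGen Step M M')
    (k : ReflTransGen Step N N') : ReflTransGen Step (.app M N) (.app M' N') :=
  (h.mapStep (Bang.app · N) (.appL N)).trans (k.mapStep (Bang.app M') (.appR M'))

theorem Step.star_es {M M' N N' : Bang} (h : ReflTransGen Step M M')
    (k : ReflTransGen Step N N') : ReflTransGen Step (.es M N) (.es M' N') :=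
  (h.mapStep (Bang.es · N) (.esL N)).trans (k.mapStep (Bang.es M') (.esR M'))

end Bang

/-! ## Inversion of the grammar of dBang approximants -/

theorem GramB.cat_of_bot {c : CatB} (h : GramB c .bot) : c = .A := by
  cases h with
  | bot => rfl
  | ofAbang _ => rfl
  | ofAlam _ => rfl

theorem GramB.toA {c : CatB} {B : Bang} (h : GramB c B) : GramB .A B := by
  cases c with
  | A => exact h
  | Abang => exact .ofAbang h
  | Alam => exact .ofAlam h

theorem GramB.of_app {c : CatB} {B C : Bang} (h : GramB c (.app B C)) :
    GramB .Alam B ∧ GramB .A C := by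
  cases h with
  | ofAbang h => cases h with | appAbang h k => exact ⟨h, k⟩
  | ofAlam h => cases h with | appAlam h k => exact ⟨h, k⟩
  | appAbang h k => exact ⟨h, k⟩
  | appAlam h k => exact ⟨h, k⟩

theorem GramB.of_es {c : CatB} {B C : Bang} (h : GramB c (.es B C)) :
    GramB c B ∧ GramB .Abang C := by
  cases h with
  | ofAbang h => cases h with | esAbang h k => exact ⟨h.toA, k⟩
  | ofAlam h => cases h with | esAlam h k => exact ⟨h.toA, k⟩
  | esA h k => exact ⟨h, k⟩
  | esAbang h k => exact ⟨h, k⟩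
  | esAlam h k => exact ⟨h, k⟩

theorem GramB.of_der {c : CatB} {B : Bang} (h : GramB c (.der B)) : GramB .Abang B := by
  cases h with
  | ofAbang h => cases h with | derAbang h => exact h
  | ofAlam h => cases h with | derAlam h => exact h
  | derAbang h => exact h
  | derAlam h => exact h

theorem GramB.of_bang {c : CatB} {B : Bang} (h : GramB c (.bang B)) :
    c ≠ .Abang ∧ GramB .A B := by
  cases h with
  | ofAbang h => cases h
  | ofAlam h => cases h with | bang h => exact ⟨by simp, h⟩
  | bang h => exact ⟨by simp, h⟩

theorem GramB.of_lam {c : CatB} {B : Bang} (h : GramB c (.lam B)) :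
    c ≠ .Alam ∧ GramB .A B := by
  cases h with
  | ofAbang h => cases h with | lam h => exact ⟨by simp, h⟩
  | ofAlam h => cases h
  | lam h => exact ⟨by simp, h⟩

/-! ## Approximants are preserved by reduction -/

/-- Only the category `A` contains `⊥`, and both other categories pass to the body of an explicit
substitution. So `B` cannot be cut off within `L` and has to reach the hole. -/
theorem GramB.exists_below_of_plug {c : CatB} (hc : c ≠ .A) (L : List Bang) :
    ∀ {B M : Bang}, GramB c B → Bang.Below B (Bang.plug L M) →
      ∃ C, GramB c C ∧ Bang.Below C M := by
  induction L with
  | nil => intro B M h k; exact ⟨B, h, k⟩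
  | cons N L ih =>
    intro B M h k
    obtain ⟨C, hC, hCM⟩ := ih h k
    cases hCM with
    | bot => exact absurd hC.cat_of_bot hc
    | es h₁ _ => exact ⟨_, hC.of_es.1, h₁⟩

theorem GramB.not_below_plug_bang {B M : Bang} {L : List Bang} (h : GramB .Abang B) :
    ¬ Bang.Below B (Bang.plug L (.bang M)) := by
  intro k
  obtain ⟨C, hC, hCM⟩ := h.exists_below_of_plug (by simp) L k
  cases hCM with
  | bot => exact absurd hC.cat_of_bot (by simp)
  | bang _ => exact hC.of_bang.1 rfl

theorem GramB.not_below_plug_lam {B M : Bang} {L : List Bang} (h : GramB .Alam B) :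
    ¬ Bang.Below B (Bang.plug L (.lam M)) := by
  intro k
  obtain ⟨C, hC, hCM⟩ := h.exists_below_of_plug (by simp) L k
  cases hCM with
  | bot => exact absurd hC.cat_of_bot (by simp)
  | lam _ => exact hC.of_lam.1 rfl

/-- A subterm of `B` matching a redex at its root would have an `Alam` below `L⟨λx M⟩` or an `Abang`
below `L⟨!M⟩`, both impossible. So the redex lies under a `⊥` of `B`, and its contraction is
invisible to `B`. -/
theorem GramB.below_of_step {N N' : Bang} (h : Bang.Step N N') :
    ∀ {c : CatB} {B : Bang}, GramB c B → Bang.Below B N → Bang.Below B N' := by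
  induction h with
  | root h =>
    intro c B hB k
    cases h with
    | beta L M N =>
      cases k with
      | bot => exact .bot _
      | app h₁ _ => exact absurd h₁ hB.of_app.1.not_below_plug_lam
    | sub L M N =>
      cases k with
      | bot => exact .bot _
      | es _ h₂ => exact absurd h₂ hB.of_es.2.not_below_plug_bang
    | der L N =>
      cases k with
      | bot => exact .bot _
      | der h₁ => exact absurd h₁ hB.of_der.not_below_plug_bang
  | lam _ ih =>
    intro c B hB k
    cases k with
    | bot => exact .bot _
    | lam k => exact .lam (ih hB.of_lam.2 k)
  | appL N _ ih =>
    intro c B hB k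
    cases k with
    | bot => exact .bot _
    | app k₁ k₂ => exact .app (ih hB.of_app.1 k₁) k₂
  | appR M _ ih =>
    intro c B hB k
    cases k with
    | bot => exact .bot _
    | app k₁ k₂ => exact .app k₁ (ih hB.of_app.2 k₂)
  | bang _ ih =>
    intro c B hB k
    cases k with
    | bot => exact .bot _
    | bang k => exact .bang (ih hB.of_bang.2 k)
  | der _ ih =>
    intro c B hB k
    cases k with
    | bot => exact .bot _
    | der k => exact .der (ih hB.of_der k)
  | esL N _ ih =>
    intro c B hB k
    cases k with
    | bot => exact .bot _
    | es k₁ k₂ => exact .es (ih hB.of_es.1 k₁) k₂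
  | esR M _ ih =>
    intro c B hB k
    cases k with
    | bot => exact .bot _
    | es k₁ k₂ => exact .es k₁ (ih hB.of_es.2 k₂)

theorem GramB.below_of_star {c : CatB} {B N N' : Bang} (hB : GramB c B)
    (h : ReflTransGen Bang.Step N N') (k : Bang.Below B N) : Bang.Below B N' := by
  induction h with
  | refl => exact k
  | tail _ h ih => exact hB.below_of_step h ih

/-! ## Call-by-name: the translation is a bisimulation -/

namespace Lam

theorem toN_rename (M : Lam) : ∀ f : ℕ → ℕ, (M.rename f).toN = M.toN.rename f := by
  induction M <;> intro f <;> simp_all [rename, toN, Bang.rename]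

theorem toN_up (σ : ℕ → Lam) : (fun i => (up σ i).toN) = Bang.up fun i => (σ i).toN := by
  funext i
  cases i with
  | zero => rfl
  | succ i => exact toN_rename _ _

theorem toN_subst (M : Lam) :
    ∀ σ : ℕ → Lam, (M.subst σ).toN = M.toN.subst fun i => (σ i).toN := by
  induction M <;> intro σ <;> simp_all [subst, toN, Bang.subst, toN_up]

theorem toN_inst (N : Lam) (k : ℕ) :
    (fun i => (inst N k i).toN) = Bang.inst N.toN k := by
  funext i
  cases i <;> rfl

theorem toN_plug (L : List Lam) : ∀ M : Lam,
    (plug L M).toN = Bang.plug (L.map fun N => .bang N.toN) M.toN := by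
  induction L with
  | nil => intro M; rfl
  | cons N L ih => intro M; exact ih _

/-- Explicit substitutions in the image arise only from explicit substitutions in the source.
Redexes at a distance can therefore be recognised in the source. -/
theorem eq_plug_of_toN_eq_plug (L : List Bang) : ∀ {M : Lam} {Q : Bang},
    M.toN = Bang.plug L Q →
      ∃ (K : List Lam) (M₀ : Lam), M = plug K M₀ ∧ M₀.toN = Q ∧
        (K.map fun N => Bang.bang N.toN) = L := by
  induction L with
  | nil => intro M Q h; exact ⟨[], M, rfl, h, rfl⟩
  | cons N L ih =>
    intro M Q h
    obtain ⟨K, M₀, rfl, h₀, rfl⟩ := ih h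
    cases M₀ <;> simp only [toN, reduceCtorEq] at h₀
    case es M₁ N₁ =>
      injection h₀ with h₁ h₂
      exact ⟨N₁ :: K, M₁, rfl, h₁, by simp [h₂]⟩

theorem toN_step {M M' : Lam} (h : StepN M M') : Bang.Step M.toN M'.toN := by
  induction h with
  | root h =>
    refine .root ?_
    cases h with
    | beta L M N =>
      have := Bang.Root.beta (L.map fun N => .bang N.toN) M.toN (.bang N.toN)
      simpa [toN, toN_plug, toN_rename, Bang.rename] using this
    | sub M N =>
      rw [toN_subst, toN_inst]
      exact .sub [] M.toN N.toN
  | lam _ ih => exact .lam ih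
  | appL N _ ih => exact .appL _ ih
  | appR M _ ih => exact .appR _ (.bang ih)
  | esL N _ ih => exact .esL _ ih
  | esR M _ ih => exact .esR _ (.bang ih)

theorem exists_step_of_toN_step (M : Lam) : ∀ {Q : Bang}, Bang.Step M.toN Q →
    ∃ M', StepN M M' ∧ M'.toN = Q := by
  induction M with
  | bot => intro Q h; cases h with | root h => cases h
  | var i => intro Q h; cases h with | root h => cases h
  | lam M ih =>
    intro Q h
    cases h with
    | root h => cases h
    | lam h =>
      obtain ⟨M', h', rfl⟩ := ih h
      exact ⟨_, .lam h', rfl⟩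
  | app M N ihM ihN =>
    intro Q h
    rw [toN] at h
    cases h with
    | root h =>
      generalize hP : M.toN = P at h
      cases h with
      | beta L M₁ _ =>
        obtain ⟨K, M₀, rfl, h₀, rfl⟩ := eq_plug_of_toN_eq_plug L hP
        cases M₀ <;> simp only [toN, reduceCtorEq] at h₀
        case lam M₂ =>
          injection h₀ with h₀
          subst h₀
          exact ⟨_, .root (.beta K M₂ N), by simp [toN, toN_plug, toN_rename, Bang.rename]⟩
    | appL _ h =>
      obtain ⟨M', h', rfl⟩ := ihM h
      exact ⟨_, .appL _ h', rfl⟩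
    | appR _ h =>
      cases h with
      | root h => cases h
      | bang h =>
        obtain ⟨N', h', rfl⟩ := ihN h
        exact ⟨_, .appR _ h', rfl⟩
  | es M N ihM ihN =>
    intro Q h
    rw [toN] at h
    cases h with
    | root h =>
      generalize hP : Bang.bang N.toN = P at h
      cases h with
      | sub L _ N₁ =>
        -- The last entry of a list context is outermost, so a nonempty `L` would make the argument
        -- an explicit substitution instead of the bang that it is.
        have hL : L = [] ∧ N₁ = N.toN := by
          rcases List.eq_nil_or_concat' L with rfl | ⟨L', R, rfl⟩
          · exact ⟨rfl, by injection hP with h; exact h.symm⟩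
          · rw [Bang.plug_append] at hP
            cases hP
        obtain ⟨rfl, rfl⟩ := hL
        exact ⟨_, .root (.sub M N), by rw [toN_subst, toN_inst]; rfl⟩
    | esL _ h =>
      obtain ⟨M', h', rfl⟩ := ihM h
      exact ⟨_, .esL _ h', rfl⟩
    | esR _ h =>
      cases h with
      | root h => cases h
      | bang h =>
        obtain ⟨N', h', rfl⟩ := ihN h
        exact ⟨_, .esR _ h', rfl⟩

theorem exists_star_of_toN_star {M : Lam} {Q : Bang} (h : ReflTransGen Bang.Step M.toN Q) :
    ∃ M', ReflTransGen StepN M M' ∧ M'.toN = Q := by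
  induction h with
  | refl => exact ⟨M, .refl, rfl⟩
  | tail _ h ih =>
    obtain ⟨M', h', rfl⟩ := ih
    obtain ⟨M'', h'', rfl⟩ := exists_step_of_toN_step M' h
    exact ⟨M'', h'.tail h'', rfl⟩

theorem Below.toN {M N : Lam} (h : Below M N) : Bang.Below M.toN N.toN := by
  induction h with
  | bot => exact .bot _
  | var i => exact .var i
  | lam _ ih => exact .lam ih
  | app _ _ ih₁ ih₂ => exact .app ih₁ (.bang ih₂)
  | es _ _ ih₁ ih₂ => exact .es ih₁ (.bang ih₂)

/-- The category is tracked because the function part of an application is an `Alam` and has to come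
from an `N_λ`. Explicit substitutions of `M` are hidden under `⊥`: their translated argument is a
bang, and no `Abang` lies below a bang. -/
theorem exists_gramN_of_below_toN (M : Lam) : ∀ {c : CatB} {B : Bang}, GramB c B →
    Bang.Below B M.toN →
      ∃ A, GramN .A A ∧ (c = .Alam → GramN .Nlam A) ∧ Below A M ∧ Bang.Below B A.toN := by
  have hbot : ∀ {c : CatB} {M : Lam}, GramB c .bot →
      ∃ A, GramN .A A ∧ (c = .Alam → GramN .Nlam A) ∧ Below A M ∧ Bang.Below .bot A.toN := by
    intro c M hB
    exact ⟨.bot, .bot, by simp [hB.cat_of_bot], .bot _, .bot _⟩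
  induction M with
  | bot => intro c B hB h; cases h; exact hbot hB
  | var i =>
    intro c B hB h
    cases h with
    | bot => exact hbot hB
    | var => exact ⟨.var i, .ofNlam (.var i), fun _ => .var i, .var i, .var i⟩
  | lam M ih =>
    intro c B hB h
    cases h with
    | bot => exact hbot hB
    | lam h =>
      obtain ⟨A, hA, -, hAM, hBA⟩ := ih hB.of_lam.2 h
      exact ⟨.lam A, .lam hA, fun e => absurd e hB.of_lam.1, .lam hAM, .lam hBA⟩
  | app M N ihM ihN =>
    intro c B hB h
    cases h with
    | bot => exact hbot hB
    | @app _ _ C _ h₁ h₂ =>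
      obtain ⟨A, -, hA, hAM, hBA⟩ := ihM hB.of_app.1 h₁
      -- The argument may be a bare `⊥`, which is no translated argument; it is enlarged to `!⊥`.
      have key : ∃ A', GramN .A A' ∧ Below A' N ∧ Bang.Below C (.bang A'.toN) := by
        cases h₂ with
        | bot => exact ⟨.bot, .bot, .bot _, .bot _⟩
        | bang h₂ =>
          obtain ⟨A', hA', -, hAN, hBA'⟩ := ihN hB.of_app.2.of_bang.2 h₂
          exact ⟨A', hA', hAN, .bang hBA'⟩
      obtain ⟨A', hA', hAN, hBA'⟩ := key
      have hG := GramN.app (hA rfl) hA'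
      exact ⟨.app A A', .ofNlam hG, fun _ => hG, .app hAM hAN, .app hBA hBA'⟩
  | es M N _ _ =>
    intro c B hB h
    cases h with
    | bot => exact hbot hB
    | es _ h₂ => exact absurd h₂ (hB.of_es.2.not_below_plug_bang (L := []))

end Lam

/-! ## Call-by-value: the translation is a bisimulation up to `der` -/

/-- `TransV false M Q`: the term `Q` is a translation of `M` where redexes `der (L⟨!P⟩)` in function
position need not have been reduced. `TransV true M P`: moreover `M = L⟨V⟩` for a value `V`, and the
bang of the translation of `V` has been removed. -/
inductive TransV : Bool → Lam → Bang → Prop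
  | bot : TransV false .bot .bot
  | varBang (i : ℕ) : TransV false (.var i) (.bang (.var i))
  | var (i : ℕ) : TransV true (.var i) (.var i)
  | lamBang {M : Lam} {Q : Bang} : TransV false M Q → TransV false (.lam M) (.bang (.lam Q))
  | lam {M : Lam} {Q : Bang} : TransV false M Q → TransV true (.lam M) (.lam Q)
  | app {M N : Lam} {P Q : Bang} : TransV true M P → TransV false N Q →
      TransV false (.app M N) (.app P Q)
  | appDer {M N : Lam} {P Q : Bang} : TransV false M P → TransV false N Q →
      TransV false (.app M N) (.app (.der P) Q)
  | es {b : Bool} {M N : Lam} {P Q : Bang} : TransV b M P → TransV false N Q →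
      TransV b (.es M N) (.es P Q)

namespace TransV

theorem of_bang {M : Lam} {P : Bang} (h : TransV false M (.bang P)) :
    M.IsValue ∧ TransV true M P := by
  cases h with
  | varBang i => exact ⟨.var i, .var i⟩
  | lamBang h => exact ⟨.lam _, .lam h⟩

/-- This needs a value and not merely some `L⟨V⟩`, for which the bang would belong inside `L`. -/
theorem bang_of_isValue {V : Lam} {P : Bang} (hV : V.IsValue) (h : TransV true V P) :
    TransV false V (.bang P) := by
  cases hV with
  | var i => cases h; exact .varBang i
  | lam M => cases h with | lam h => exact .lamBang h

theorem plug {b : Bool} {K : List Lam} {L : List Bang} (h : List.Forall₂ (TransV false) K L) :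
    ∀ {M : Lam} {Q : Bang}, TransV b M Q → TransV b (Lam.plug K M) (Bang.plug L Q) := by
  induction h with
  | nil => intro M Q h; exact h
  | cons h₁ _ ih => intro M Q h; exact ih (.es h h₁)

theorem of_plug_right {b : Bool} (L : List Bang) : ∀ {M : Lam} {Q : Bang},
    TransV b M (Bang.plug L Q) → ∃ (K : List Lam) (M₀ : Lam),
      M = Lam.plug K M₀ ∧ TransV b M₀ Q ∧ List.Forall₂ (TransV false) K L := by
  induction L with
  | nil => intro M Q h; exact ⟨[], M, rfl, h, .nil⟩
  | cons N L ih =>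
    intro M Q h
    obtain ⟨K, M₀, rfl, h₀, hK⟩ := ih h
    cases h₀ with | es h₁ h₂ => exact ⟨_ :: K, _, rfl, h₁, .cons h₂ hK⟩

theorem of_plug_left {b : Bool} (K : List Lam) : ∀ {M : Lam} {Q : Bang},
    TransV b (Lam.plug K M) Q → ∃ (L : List Bang) (Q₀ : Bang),
      Q = Bang.plug L Q₀ ∧ TransV b M Q₀ ∧ List.Forall₂ (TransV false) K L := by
  induction K with
  | nil => intro M Q h; exact ⟨[], Q, rfl, h, .nil⟩
  | cons N K ih =>
    intro M Q h
    obtain ⟨L, Q₀, rfl, h₀, hL⟩ := ih h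
    cases h₀ with | es h₁ h₂ => exact ⟨_ :: L, _, rfl, h₁, .cons h₂ hL⟩

theorem of_plug_bang {L : List Bang} {M : Lam} {P : Bang}
    (h : TransV false M (Bang.plug L (.bang P))) : TransV true M (Bang.plug L P) := by
  obtain ⟨K, M₀, rfl, h₀, hK⟩ := of_plug_right L h
  exact plug hK h₀.of_bang.2

theorem rename {b : Bool} {M : Lam} {Q : Bang} (h : TransV b M Q) :
    ∀ f : ℕ → ℕ, TransV b (M.rename f) (Q.rename f) := by
  induction h with
  | bot => intro f; exact .bot
  | varBang i => intro f; exact .varBang _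
  | var i => intro f; exact .var _
  | lamBang _ ih => intro f; exact .lamBang (ih _)
  | lam _ ih => intro f; exact .lam (ih _)
  | app _ _ ih₁ ih₂ => intro f; exact .app (ih₁ f) (ih₂ f)
  | appDer _ _ ih₁ ih₂ => intro f; exact .appDer (ih₁ f) (ih₂ f)
  | es _ _ ih₁ ih₂ => intro f; exact .es (ih₁ _) (ih₂ f)

theorem up {σ : ℕ → Lam} {τ : ℕ → Bang} (h : ∀ i, (σ i).IsValue ∧ TransV true (σ i) (τ i)) :
    ∀ i, (Lam.up σ i).IsValue ∧ TransV true (Lam.up σ i) (Bang.up τ i) := by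
  intro i
  cases i with
  | zero => exact ⟨.var 0, .var 0⟩
  | succ i =>
    refine ⟨?_, (h i).2.rename _⟩
    obtain ⟨h, -⟩ := h i
    simp only [Lam.up]
    generalize σ i = V at h
    cases h with
    | var j => exact .var _
    | lam M => exact .lam _

theorem inst {V : Lam} {P : Bang} (hV : V.IsValue) (h : TransV true V P) (k : ℕ) :
    ∀ i, (Lam.inst V k i).IsValue ∧ TransV true (Lam.inst V k i) (Bang.inst P k i) := by
  intro i
  cases i with
  | zero => exact ⟨hV, h⟩
  | succ i => exact ⟨.var _, .var _⟩

/-- A variable occurs in the image either as `x` or as `!x`, so the substituted terms must be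
admissible both bare and under a bang. Requiring values ensures this. -/
theorem subst {b : Bool} {M : Lam} {Q : Bang} (h : TransV b M Q) :
    ∀ {σ : ℕ → Lam} {τ : ℕ → Bang}, (∀ i, (σ i).IsValue ∧ TransV true (σ i) (τ i)) →
      TransV b (M.subst σ) (Q.subst τ) := by
  induction h with
  | bot => intro σ τ _; exact .bot
  | varBang i => intro σ τ hσ; exact bang_of_isValue (hσ i).1 (hσ i).2
  | var i => intro σ τ hσ; exact (hσ i).2
  | lamBang _ ih => intro σ τ hσ; exact .lamBang (ih (up hσ))
  | lam _ ih => intro σ τ hσ; exact .lam (ih (up hσ))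
  | app _ _ ih₁ ih₂ => intro σ τ hσ; exact .app (ih₁ hσ) (ih₂ hσ)
  | appDer _ _ ih₁ ih₂ => intro σ τ hσ; exact .appDer (ih₁ hσ) (ih₂ hσ)
  | es _ _ ih₁ ih₂ => intro σ τ hσ; exact .es (ih₁ (up hσ)) (ih₂ hσ)

theorem beta {K : List Lam} {L : List Bang} (hK : List.Forall₂ (TransV false) K L) {M N : Lam}
    {P Q : Bang} (hM : TransV false M P) (hN : TransV false N Q) :
    TransV false (Lam.plug K (.es M (N.rename (· + K.length))))
      (Bang.plug L (.es P (Q.rename (· + L.length)))) := by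
  rw [hK.length_eq]
  exact plug hK (.es hM (hN.rename _))

theorem sub {b : Bool} {K : List Lam} {L : List Bang} (hK : List.Forall₂ (TransV false) K L)
    {M V : Lam} {P Q : Bang} (hM : TransV b M P) (hV : V.IsValue) (hQ : TransV true V Q) :
    TransV b (Lam.plug K (M.subst (Lam.inst V K.length)))
      (Bang.plug L (P.subst (Bang.inst Q L.length))) := by
  rw [hK.length_eq]
  exact plug hK (hM.subst (inst hV hQ _))

/-! ### Simulation along `TransV` in both directions. -/

theorem exists_of_step {b : Bool} {M : Lam} {Q : Bang} (h : TransV b M Q) :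
    ∀ {Q' : Bang}, Bang.Step Q Q' → ∃ M', ReflTransGen Lam.StepV M M' ∧ TransV b M' Q' := by
  induction h with
  | bot => intro Q' h; cases h with | root h => cases h
  | varBang i =>
    intro Q' h
    cases h with
    | root h => cases h
    | bang h => cases h with | root h => cases h
  | var i => intro Q' h; cases h with | root h => cases h
  | lamBang _ ih =>
    intro Q' h
    cases h with
    | root h => cases h
    | bang h =>
      cases h with
      | root h => cases h
      | lam h =>
        obtain ⟨M', h', k⟩ := ih h
        exact ⟨.lam M', h'.mapStep Lam.lam .lam, .lamBang k⟩
  | lam _ ih =>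
    intro Q' h
    cases h with
    | root h => cases h
    | lam h =>
      obtain ⟨M', h', k⟩ := ih h
      exact ⟨.lam M', h'.mapStep Lam.lam .lam, .lam k⟩
  | @app M N _ _ h₁ h₂ ih₁ ih₂ =>
    intro Q' h
    cases h with
    | root h =>
      cases h with
      | beta L P _ =>
        obtain ⟨K, M₀, rfl, h₀, hK⟩ := of_plug_right L h₁
        cases h₀ with
        | lam h₀ => exact ⟨_, .single (.root (.beta K _ N)), beta hK h₀ h₂⟩
    | appL _ h =>
      obtain ⟨M', h', k⟩ := ih₁ h
      exact ⟨.app M' N, h'.mapStep (Lam.app · N) (.appL N), .app k h₂⟩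
    | appR _ h =>
      obtain ⟨N', h', k⟩ := ih₂ h
      exact ⟨.app M N', h'.mapStep (Lam.app M) (.appR M), .app h₁ k⟩
  | @appDer M N P _ h₁ h₂ ih₁ ih₂ =>
    intro Q' h
    cases h with
    | root h =>
      generalize hR : Bang.der P = R at h
      cases h with
      | beta L P _ =>
        rcases List.eq_nil_or_concat' L with rfl | ⟨L', R, rfl⟩
        · cases hR
        · rw [Bang.plug_append] at hR
          cases hR
    | appL _ h =>
      cases h with
      -- The administrative step: the source does not move, and only the witness changes from
      -- `appDer` to `app`.
      | root h => cases h with | der L R => exact ⟨_, .refl, .app h₁.of_plug_bang h₂⟩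
      | der h =>
        obtain ⟨M', h', k⟩ := ih₁ h
        exact ⟨.app M' N, h'.mapStep (Lam.app · N) (.appL N), .appDer k h₂⟩
    | appR _ h =>
      obtain ⟨N', h', k⟩ := ih₂ h
      exact ⟨.app M N', h'.mapStep (Lam.app M) (.appR M), .appDer h₁ k⟩
  | @es _ M N _ _ h₁ h₂ ih₁ ih₂ =>
    intro Q' h
    cases h with
    | root h =>
      cases h with
      | sub L _ R =>
        obtain ⟨K, V, rfl, h₀, hK⟩ := of_plug_right L h₂
        exact ⟨_, .single (.root (.sub K M V h₀.of_bang.1)), sub hK h₁ h₀.of_bang.1 h₀.of_bang.2⟩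
    | esL _ h =>
      obtain ⟨M', h', k⟩ := ih₁ h
      exact ⟨.es M' N, h'.mapStep (Lam.es · N) (.esL N), .es k h₂⟩
    | esR _ h =>
      obtain ⟨N', h', k⟩ := ih₂ h
      exact ⟨.es M N', h'.mapStep (Lam.es M) (.esR M), .es h₁ k⟩

theorem exists_of_star {b : Bool} {M : Lam} {Q Q' : Bang} (h : TransV b M Q)
    (k : ReflTransGen Bang.Step Q Q') :
    ∃ M', ReflTransGen Lam.StepV M M' ∧ TransV b M' Q' := by
  induction k with
  | refl => exact ⟨M, .refl, h⟩
  | tail _ k ih =>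
    obtain ⟨M', h', k'⟩ := ih
    obtain ⟨M'', h'', k''⟩ := k'.exists_of_step k
    exact ⟨M'', h'.trans h'', k''⟩

theorem exists_of_stepV {M M' : Lam} (h : Lam.StepV M M') :
    ∀ {b : Bool} {Q : Bang}, TransV b M Q →
      ∃ Q', ReflTransGen Bang.Step Q Q' ∧ TransV b M' Q' := by
  induction h with
  | root h =>
    intro b Q k
    cases h with
    | beta K M N =>
      cases k with
      | app k₁ k₂ =>
        obtain ⟨L, Q₀, rfl, h₀, hL⟩ := of_plug_left K k₁
        cases h₀ with
        | lam h₀ => exact ⟨_, .single (.root (.beta L _ _)), beta hL h₀ k₂⟩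
      | appDer k₁ k₂ =>
        obtain ⟨L, Q₀, rfl, h₀, hL⟩ := of_plug_left K k₁
        cases h₀ with
        | lamBang h₀ =>
          -- One source step costs two dBang steps here: the pending `der` must be contracted before
          -- the abstraction is exposed.
          exact ⟨_, .head (.appL _ (.root (.der L _))) (.single (.root (.beta L _ _))),
            beta hL h₀ k₂⟩
    | sub K M V hV =>
      cases k with
      | es k₁ k₂ =>
        obtain ⟨L, Q₀, rfl, h₀, hL⟩ := of_plug_left K k₂
        obtain ⟨R, rfl⟩ : ∃ R, Q₀ = .bang R := by
          cases hV with
          | var i => cases h₀; exact ⟨_, rfl⟩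
          | lam M => cases h₀; exact ⟨_, rfl⟩
        exact ⟨_, .single (.root (.sub L _ _)), sub hL k₁ hV h₀.of_bang.2⟩
  | lam _ ih =>
    intro b Q k
    cases k with
    | lamBang k =>
      obtain ⟨Q', h', k'⟩ := ih k
      exact ⟨_, Bang.Step.star_bang (Bang.Step.star_lam h'), .lamBang k'⟩
    | lam k =>
      obtain ⟨Q', h', k'⟩ := ih k
      exact ⟨_, Bang.Step.star_lam h', .lam k'⟩
  | appL N _ ih =>
    intro b Q k
    cases k with
    | app k₁ k₂ =>
      obtain ⟨Q', h', k'⟩ := ih k₁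
      exact ⟨_, Bang.Step.star_app h' .refl, .app k' k₂⟩
    | appDer k₁ k₂ =>
      obtain ⟨Q', h', k'⟩ := ih k₁
      exact ⟨_, Bang.Step.star_app (Bang.Step.star_der h') .refl, .appDer k' k₂⟩
  | appR M _ ih =>
    intro b Q k
    cases k with
    | app k₁ k₂ =>
      obtain ⟨Q', h', k'⟩ := ih k₂
      exact ⟨_, Bang.Step.star_app .refl h', .app k₁ k'⟩
    | appDer k₁ k₂ =>
      obtain ⟨Q', h', k'⟩ := ih k₂
      exact ⟨_, Bang.Step.star_app .refl h', .appDer k₁ k'⟩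
  | esL N _ ih =>
    intro b Q k
    cases k with
    | es k₁ k₂ =>
      obtain ⟨Q', h', k'⟩ := ih k₁
      exact ⟨_, Bang.Step.star_es h' .refl, .es k' k₂⟩
  | esR M _ ih =>
    intro b Q k
    cases k with
    | es k₁ k₂ =>
      obtain ⟨Q', h', k'⟩ := ih k₂
      exact ⟨_, Bang.Step.star_es .refl h', .es k₁ k'⟩

theorem exists_of_starV {b : Bool} {M M' : Lam} {Q : Bang} (h : TransV b M Q)
    (k : ReflTransGen Lam.StepV M M') :
    ∃ Q', ReflTransGen Bang.Step Q Q' ∧ TransV b M' Q' := by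
  induction k with
  | refl => exact ⟨Q, .refl, h⟩
  | tail _ k ih =>
    obtain ⟨Q', h', k'⟩ := ih
    obtain ⟨Q'', h'', k''⟩ := exists_of_stepV k k'
    exact ⟨Q'', h'.trans h'', k''⟩

theorem toV (M : Lam) : TransV false M M.toV := by
  induction M with
  | bot => exact .bot
  | var i => exact .varBang i
  | lam M ih => exact .lamBang ih
  | app M N ihM ihN =>
    rw [Lam.toV]
    cases e : M.toV.unbang with
    | none => exact .appDer ihM ihN
    | some R =>
      obtain ⟨L, P, hM, rfl⟩ := (Bang.unbang_eq_some _ _).1 e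
      rw [hM] at ihM
      exact .app ihM.of_plug_bang ihN
  | es M N ihM ihN => exact .es ihM ihN

/-- `Q` differs from the actual translation only by pending `der` redexes, and contracting them all
suffices. For `b = true` the target is the translation with the bang of its value removed. -/
theorem star_toV {b : Bool} {M : Lam} {Q : Bang} (h : TransV b M Q) :
    cond b (∃ R, M.toV.unbang = some R ∧ ReflTransGen Bang.Step Q R)
      (ReflTransGen Bang.Step Q M.toV) := by
  induction h with
  | bot => exact .refl
  | varBang i => exact .refl
  | var i => exact ⟨_, rfl, .refl⟩
  | lamBang _ ih => exact Bang.Step.star_bang (Bang.Step.star_lam ih)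
  | lam _ ih => exact ⟨_, rfl, Bang.Step.star_lam ih⟩
  | app _ _ ih₁ ih₂ =>
    obtain ⟨R, hR, h⟩ := ih₁
    simp only [cond_false, Lam.toV, hR, Option.getD_some]
    exact Bang.Step.star_app h ih₂
  | @appDer M _ _ _ _ _ ih₁ ih₂ =>
    refine Bang.Step.star_app ((Bang.Step.star_der ih₁).trans ?_) ih₂
    cases e : M.toV.unbang with
    | none => exact .refl
    | some R =>
      obtain ⟨L, P, hM, rfl⟩ := (Bang.unbang_eq_some _ _).1 e
      rw [hM]
      exact .single (.root (.der L P))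
  | @es b _ _ _ _ _ _ ih₁ ih₂ =>
    cases b with
    | false => exact Bang.Step.star_es ih₁ ih₂
    | true =>
      obtain ⟨R, hR, h⟩ := ih₁
      exact ⟨.es R _, by simp [Lam.toV, Bang.unbang, hR], Bang.Step.star_es h ih₂⟩

end TransV

namespace Lam

theorem toV_star {M M' : Lam} (h : ReflTransGen StepV M M') :
    ReflTransGen Bang.Step M.toV M'.toV := by
  obtain ⟨Q, hQ, k⟩ := (TransV.toV M).exists_of_starV h
  exact hQ.trans k.star_toV

theorem exists_star_of_toV_star {M : Lam} {Q : Bang} (h : ReflTransGen Bang.Step M.toV Q) :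
    ∃ M', ReflTransGen StepV M M' ∧ ReflTransGen Bang.Step Q M'.toV := by
  obtain ⟨M', hM', k⟩ := (TransV.toV M).exists_of_star h
  exact ⟨M', hM', k.star_toV⟩

end Lam

/-! ### Call-by-value approximants and their images. -/

/-- The call-by-value translation is monotone on approximants, although it is not on all terms:
`⊥ x ⊑ y x`, but `der(⊥) !x` is not below `y !x`. -/
theorem GramV.below_toV {c : CatV} {A : Lam} (h : GramV c A) : ∀ {N : Lam}, Lam.Below A N →
    Bang.Below A.toV N.toV ∧
      (c ≠ .A → Option.Rel Bang.Below A.toV.unbang N.toV.unbang) := by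
  -- `Option.Rel` says that both sides have the form `L⟨!P⟩` or neither does, so both applications
  -- are translated by the same clause. It fails for `⊥`, whence the restriction `c ≠ .A`.
  have happ : ∀ {c : CatV} {A B M N : Lam}, Bang.Below A.toV M.toV →
      Option.Rel Bang.Below A.toV.unbang M.toV.unbang → Bang.Below B.toV N.toV →
      Bang.Below (Lam.app A B).toV (Lam.app M N).toV ∧
        (c ≠ .A → Option.Rel Bang.Below (Lam.app A B).toV.unbang (Lam.app M N).toV.unbang) := by
    intro c A B M N h h' k
    refine ⟨.app ?_ k, fun _ => .none⟩
    revert h'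
    generalize A.toV.unbang = o, M.toV.unbang = o'
    intro h'
    cases h' with
    | none => exact .der h
    | some h => exact h
  have hes : ∀ {c : CatV} {A B M N : Lam}, (Bang.Below A.toV M.toV ∧
      (c ≠ .A → Option.Rel Bang.Below A.toV.unbang M.toV.unbang)) → Bang.Below B.toV N.toV →
      Bang.Below (Lam.es A B).toV (Lam.es M N).toV ∧
        (c ≠ .A → Option.Rel Bang.Below (Lam.es A B).toV.unbang (Lam.es M N).toV.unbang) := by
    intro c A B M N h k
    refine ⟨.es h.1 k, fun hc => ?_⟩
    have h' := h.2 hc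
    simp only [Lam.toV, Bang.unbang]
    revert h'
    generalize A.toV.unbang = o, M.toV.unbang = o'
    intro h'
    cases h' with
    | none => exact .none
    | some h => exact .some (.es h k)
  induction h with
  | bot => intro N _; exact ⟨.bot _, by simp⟩
  | ofAlam _ ih => intro N k; exact ⟨(ih k).1, by simp⟩
  | lam _ ih =>
    intro N k
    cases k with | lam k => exact ⟨.bang (.lam (ih k).1), by simp⟩
  | var i => intro N k; cases k; exact ⟨.bang (.var i), fun _ => .some (.var i)⟩
  | esA _ _ ih₁ ih₂ =>
    intro N k
    cases k with | es k₁ k₂ => exact hes (ih₁ k₁) (ih₂ k₂).1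
  | esAlam _ _ ih₁ ih₂ =>
    intro N k
    cases k with | es k₁ k₂ => exact hes (ih₁ k₁) (ih₂ k₂).1
  | esAxlam _ _ ih₁ ih₂ =>
    intro N k
    cases k with | es k₁ k₂ => exact hes (ih₁ k₁) (ih₂ k₂).1
  | appAlam _ _ ih₁ ih₂ =>
    intro N k
    cases k with | app k₁ k₂ => exact happ (ih₁ k₁).1 ((ih₁ k₁).2 (by simp)) (ih₂ k₂).1
  | appAxlam _ _ ih₁ ih₂ =>
    intro N k
    cases k with | app k₁ k₂ => exact happ (ih₁ k₁).1 ((ih₁ k₁).2 (by simp)) (ih₂ k₂).1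

theorem GramV.alam_of_axlam {c : CatV} {A : Lam} (h : GramV c A) (hc : c = .Axlam) :
    GramV .Alam A := by
  induction h with
  | appAxlam h k => exact .appAlam h k
  | esAxlam _ k ih _ => exact .esAlam (ih rfl) k
  | _ => cases hc

/-- The three claims follow the positions in which a translated subterm is met. The second serves
arguments of explicit substitutions and bodies of `der`: an `Abang` is never below `L⟨!P⟩`, so its
source can be taken in `A_xλ`. The third serves functions whose `der` has been contracted, where the
comparison is with the translation stripped of its bang. -/
theorem Lam.exists_gramV_of_below_toV (M : Lam) :
    (∀ {B : Bang}, GramB .A B → Bang.Below B M.toV →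
      ∃ A, GramV .A A ∧ Lam.Below A M ∧ Bang.Below B A.toV) ∧
    (∀ {B : Bang}, GramB .Abang B → Bang.Below B M.toV →
      ∃ A, GramV .Axlam A ∧ Lam.Below A M ∧ Bang.Below B A.toV) ∧
    (∀ {B R : Bang}, GramB .Alam B → M.toV.unbang = some R → Bang.Below B R →
      ∃ A S, GramV .Alam A ∧ Lam.Below A M ∧ A.toV.unbang = some S ∧ Bang.Below B S) := by
  have hbot : ∀ {M : Lam}, ∃ A, GramV .A A ∧ Lam.Below A M ∧ Bang.Below .bot A.toV :=
    ⟨.bot, .bot, .bot _, .bot _⟩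
  induction M with
  | bot =>
    refine ⟨fun _ h => ?_, fun hB h => ?_, fun _ h _ => by simp [toV, Bang.unbang] at h⟩
    · cases h; exact hbot
    · cases h; exact absurd hB.cat_of_bot (by simp)
  | var i =>
    refine ⟨fun {B} _ h => ?_, fun hB h => absurd h (hB.not_below_plug_bang (L := [])),
      fun {B R} hB e h => ?_⟩
    · cases h with
      | bot => exact hbot
      | bang h =>
        refine ⟨.var i, .ofAlam (.var i), .var i, .bang ?_⟩
        cases h with
        | bot => exact .bot _
        | var => exact .var i
    · cases e
      exact ⟨.var i, .var i, .var i, .var i, rfl, h⟩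
  | lam M ih =>
    refine ⟨fun {B} hB h => ?_, fun hB h => absurd h (hB.not_below_plug_bang (L := [])),
      fun {B R} hB e h => ?_⟩
    · cases h with
      | bot => exact hbot
      | bang h =>
        cases h with
        -- `!⊥` is not a translation; `λx ⊥` is the approximant of `λx M` whose image dominates it.
        | bot => exact ⟨.lam .bot, .lam .bot, .lam (.bot _), .bang (.bot _)⟩
        | lam h =>
          obtain ⟨A, hA, hAM, hBA⟩ := ih.1 hB.of_bang.2.of_lam.2 h
          exact ⟨.lam A, .lam hA, .lam hAM, .bang (.lam hBA)⟩
    · cases e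
      exact absurd h (hB.not_below_plug_lam (L := []))
  | app M N ihM ihN =>
    have key : ∀ {B C : Bang}, GramB .Alam B → GramB .A C →
        Bang.Below (.app B C) (Lam.app M N).toV → ∃ A A', GramV .Alam A ∧ GramV .A A' ∧
          Lam.Below (.app A A') (.app M N) ∧ Bang.Below (.app B C) (Lam.app A A').toV := by
      intro B C hB hC h
      rw [toV] at h
      cases h with
      | app h₁ h₂ =>
        obtain ⟨A', hA', hAN, hCA⟩ := ihN.1 hC h₂
        cases e : M.toV.unbang with
        | none =>
          rw [e] at h₁
          cases h₁ with
          | bot => exact absurd hB.cat_of_bot (by simp)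
          | der h₁ =>
            obtain ⟨A, hA, hAM, hBA⟩ := ihM.2.1 hB.of_der h₁
            refine ⟨A, A', hA.alam_of_axlam rfl, hA', .app hAM hAN, ?_⟩
            rw [toV, (hA.toV.2.1 rfl).2.2]
            exact .app (.der hBA) hCA
        | some R =>
          rw [e] at h₁
          obtain ⟨A, S, hA, hAM, hS, hBS⟩ := ihM.2.2 hB e h₁
          refine ⟨A, A', hA, hA', .app hAM hAN, ?_⟩
          rw [toV, hS]
          exact .app hBS hCA
    refine ⟨fun {B} hB h => ?_, fun {B} hB h => ?_,
      fun _ h _ => by simp [toV, Bang.unbang] at h⟩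
    · have h' := h
      rw [toV] at h'
      cases h' with
      | bot => exact hbot
      | app _ _ =>
        obtain ⟨A, A', hA, hA', k, k'⟩ := key hB.of_app.1 hB.of_app.2 h
        exact ⟨_, .ofAlam (.appAlam hA hA'), k, k'⟩
    · have h' := h
      rw [toV] at h'
      cases h' with
      | bot => exact absurd hB.cat_of_bot (by simp)
      | app _ _ =>
        obtain ⟨A, A', hA, hA', k, k'⟩ := key hB.of_app.1 hB.of_app.2 h
        exact ⟨_, .appAxlam hA hA', k, k'⟩
  | es M N ihM ihN =>
    refine ⟨fun {B} hB h => ?_, fun {B} hB h => ?_, fun {B R} hB e h => ?_⟩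
    · cases h with
      | bot => exact hbot
      | es h₁ h₂ =>
        obtain ⟨A, hA, hAM, hBA⟩ := ihM.1 hB.of_es.1 h₁
        obtain ⟨A', hA', hAN, hCA⟩ := ihN.2.1 hB.of_es.2 h₂
        exact ⟨_, .esA hA hA', .es hAM hAN, .es hBA hCA⟩
    · cases h with
      | bot => exact absurd hB.cat_of_bot (by simp)
      | es h₁ h₂ =>
        obtain ⟨A, hA, hAM, hBA⟩ := ihM.2.1 hB.of_es.1 h₁
        obtain ⟨A', hA', hAN, hCA⟩ := ihN.2.1 hB.of_es.2 h₂
        exact ⟨_, .esAxlam hA hA', .es hAM hAN, .es hBA hCA⟩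
    · simp only [toV, Bang.unbang, Option.map_eq_some_iff] at e
      obtain ⟨R, e, rfl⟩ := e
      cases h with
      | bot => exact absurd hB.cat_of_bot (by simp)
      | es h₁ h₂ =>
        obtain ⟨A, S, hA, hAM, hS, hBS⟩ := ihM.2.2 hB.of_es.1 e h₁
        obtain ⟨A', hA', hAN, hCA⟩ := ihN.2.1 hB.of_es.2 h₂
        exact ⟨_, .es S A'.toV, .esAlam hA hA', .es hAM hAN,
          by simp [toV, Bang.unbang, hS], .es hBS hCA⟩

/-! ## Böhm trees -/

theorem treeToN_BTn (M : Lam) : treeToN (BTn M) = BTb M.toN := by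
  ext B
  constructor
  · rintro ⟨_, ⟨A, ⟨N, hN, hA⟩, rfl⟩, hBA⟩
    exact ⟨N.toN, hN.mapStep Lam.toN Lam.toN_step, Bang.Below.trans hBA hA.toN⟩
  · rintro ⟨Q, hQ, hB⟩
    obtain ⟨M', hM', rfl⟩ := Lam.exists_star_of_toN_star hQ
    obtain ⟨A, hA, -, hAM, hBA⟩ := Lam.exists_gramN_of_below_toN M' B.2 hB
    exact ⟨_, ⟨⟨A, hA⟩, ⟨M', hM', hAM⟩, rfl⟩, hBA⟩

theorem treeToV_BTv (M : Lam) : treeToV (BTv M) = BTb M.toV := by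
  ext B
  constructor
  · rintro ⟨_, ⟨A, ⟨N, hN, hA⟩, rfl⟩, hBA⟩
    exact ⟨N.toV, Lam.toV_star hN, Bang.Below.trans hBA (A.2.below_toV hA).1⟩
  · rintro ⟨Q, hQ, hB⟩
    obtain ⟨M', hM', hQM⟩ := Lam.exists_star_of_toV_star hQ
    -- `B` is below `Q` and so survives the administrative reduction from `Q` to `M'.toV`.
    obtain ⟨A, hA, hAM, hBA⟩ :=
      (Lam.exists_gramV_of_below_toV M').1 B.2 (B.2.below_of_star hQM hB)
    exact ⟨_, ⟨⟨A, hA⟩, ⟨M', hM', hAM⟩, rfl⟩, hBA⟩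

/-- Böhm trees commute with the call-by-name and call-by-value translations into dBang. -/
theorem mainTheorem3 :
    (∀ M : Lam, M.BotFree → treeToN (BTn M) = BTb M.toN) ∧
    (∀ M : Lam, M.BotFree → treeToV (BTv M) = BTb M.toV) :=
  ⟨fun M _ => treeToN_BTn M, fun M _ => treeToV_BTv M⟩
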